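/- Let $\tau\neq 0$ be a point of the Riemann surface of the logarithm with $|\arg\tau|<3\pi/2$; that is, $\tau$ is given by a value $\ell=\log|\tau|+i\arg\tau$ of its logarithm with $|\operatorname{Im}\ell|<3\pi/2$, powers are $\tau^{w}=e^{w\ell}$, and $\tau^{-1}$ and $\pi\tau^{\pm1}n^2$ have the logarithms $-\ell$ and $\pm\ell+\log(\pi n^2)$. For $a\in\mathbb C$ and a point $x\ne0$ of this surface let $$\Gamma(a,x)=\int_x^{\infty}t^{a-1}e^{-t}\,dt$$ be the upper incomplete gamma function, where the path of integration on the surface goes from $x$ to $|x|$ (of argument $0$) along the circular arc $|t|=|x|$ and then to $+\infty$ along the positive half-line; let $Q(a,x)=\Gamma(a,x)/\Gamma(a)$ be the normalized incomplete gamma function. Then for every $s\in\mathbb C\setminus\{0,1\}$ with $-1<\operatorname{Re}s<2$ both series below converge absolutely, and $$\pi^{-s/2}\Gamma(s/2)\zeta(s)=-\frac{\pi\tau^{s/2}}{\sin(\pi s/2)}\Big[\frac12+\sum_{n\ge1}e^{\pi\tau n^2}Q\big(-s/2,\pi\tau n^2\big)\Big]-\frac{\pi\tau^{(s-1)/2}}{\cos(\pi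 s/2)}\Big[\frac12+\sum_{n\ge1}e^{\pi\tau^{-1}n^2}Q\big((s-1)/2,\pi\tau^{-1}n^2\big)\Big],$$ where $\zeta$ is the Riemann zeta function. -/

import Mathlib

/-- The upper incomplete gamma function `Γ(a, x) = ∫_x^∞ t^(a-1) e^(-t) dt` on the Riemann surface
of the logarithm: the point `x` lying over `e^ℓ`, with `|x| = e^(Re ℓ)` and `arg x = Im ℓ` (any real
number), is given by its logarithm `ℓ`.  The path of integration runs from `x` to `|x|` along the
circular arc `e^(Re ℓ + iv)`, with `v` from `Im ℓ` to `0`, and then from `|x|` to `+∞` along the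
positive half-line.  On the arc `t = e^u`, so that `t^(a-1) e^(-t) dt = exp (a u - e^u) du`. -/
noncomputable def upperIncompleteGamma (a ℓ : ℂ) : ℂ :=
  (∫ v in (ℓ.im)..0,
      Complex.exp (a * (ℓ.re + v * Complex.I) - Complex.exp (ℓ.re + v * Complex.I)) * Complex.I)
    + ∫ t in Set.Ioi (Real.exp ℓ.re), (t : ℂ) ^ (a - 1) * Complex.exp (-(t : ℂ))

/-- The normalized incomplete gamma function `Q(a, x) = Γ(a, x) / Γ(a)`, where the point `x` of the
Riemann surface of the logarithm is given by its logarithm `ℓ`. -/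
noncomputable def normalizedIncompleteGamma (a ℓ : ℂ) : ℂ :=
  upperIncompleteGamma a ℓ / Complex.Gamma a

/-- The term `e^x Q(a, x)` with `x = π τ n²`, for `τ` of logarithm `ℓ` and `n ≥ 1`; so `x` has
logarithm `ℓ + log (π n²)`. -/
noncomputable def expQTerm (a ℓ : ℂ) (n : ℕ) : ℂ :=
  Complex.exp (Real.pi * Complex.exp ℓ * (n : ℂ) ^ 2) *
    normalizedIncompleteGamma a (ℓ + (Real.log (Real.pi * (n : ℝ) ^ 2) : ℝ))

section
open Complex Set MeasureTheory Filter Topology Asymptotics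

/-! Write `τ = c y` on the Riemann surface, with `Re c > 0` and `y` off the closed negative
half-line; this reaches exactly `|arg τ| < π/2 + π`. The factor `c` makes exponentials decay, while
`y` enters only through the kernel `1/(y + r)`.

The Stieltjes representation `Γ(1-w, cy) e^(cy) Γ(w) = y^(1-w) ∫₀^∞ r^(w-1) e^(-cr) / (y+r) dr`,
with `c` scaled by `π n²`, turns each series into a Mellin transform: with `θ(z) = ∑ e^(-π n² z)`,
the first is that of `θ(cr)/(y+r)` at `w = s/2 + 1`, the second that of `θ(r/c)/(1/y+r)` at `w =
(3-s)/2`. Both converge for `Re w > 1/2`, that is, for `-1 < Re s < 2`.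

In the second integral put `r → 1/r` and apply the modular relation of `θ`. The kernel becomes
`yr/(y+r)`, and `y/(y+r) = 1 - r/(y+r)` splits the result into Riemann's integral for the completed
zeta function, minus the first Mellin transform, plus elementary integrals of `1/(y+r)` that give
the terms in `1/sin` and `1/cos`. This needs `1 < Re s < 2`; the identity theorem extends it to the
whole strip.

The weight is carried by `upperIncompleteGamma_mul_exp_mul_Gamma`, `hasSum_expQTerm`,
`mellin_halfTheta_inv_mul_inv_add` and `completedRiemannZeta_eq_of_differentiableAt`. -/

theorem eqOn_of_eq_ofReal_pos {f g : ℂ → ℂ} {U : Set ℂ} (hU : IsOpen U) (hc : IsPreconnected U)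
    (h1 : 1 ∈ U) (hf : DifferentiableOn ℂ f U) (hg : DifferentiableOn ℂ g U)
    (h : ∀ t : ℝ, 0 < t → f t = g t) : EqOn f g U := by
  refine (hf.analyticOnNhd hU).eqOn_of_preconnected_of_frequently_eq (hg.analyticOnNhd hU) hc h1 ?_
  have hT : Tendsto (fun n : ℕ => (((1 : ℝ) + 1 / ((n : ℝ) + 1) : ℝ) : ℂ)) atTop (𝓝[≠] 1) := by
    refine tendsto_nhdsWithin_iff.2 ⟨?_, .of_forall fun n => ?_⟩
    · have := (tendsto_const_nhds (x := (1 : ℝ))).add (tendsto_one_div_add_atTop_nhds_zero_nat (𝕜 := ℝ))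
      rw [add_zero] at this
      exact (ofReal_one ▸ (continuous_ofReal.tendsto 1).comp this)
    · have : (0 : ℝ) < 1 / ((n : ℝ) + 1) := by positivity
      rw [mem_compl_iff, mem_singleton_iff, ofReal_eq_one]
      linarith
  refine hT.frequently (Frequently.of_forall fun n => h _ (by positivity))

/-! ### The incomplete gamma function on the logarithmic surface. -/

theorem integrableOn_gammaIntegrand_Ioi (a : ℂ) {x : ℝ} (hx : 0 < x) :
    IntegrableOn (fun t : ℝ => (t : ℂ) ^ (a - 1) * exp (-(t : ℂ))) (Ioi x) := by
  have hr : IntegrableOn (fun t : ℝ => Real.exp (-t) * t ^ (a.re - 1)) (Ioi x) := by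
    refine integrable_of_isBigO_exp_neg (b := 1 / 2) (by norm_num) ?_ ?_
    · refine fun t ht => ContinuousAt.continuousWithinAt ?_
      have : 0 < t := hx.trans_le ht
      exact ContinuousAt.mul (by fun_prop) (Real.continuousAt_rpow_const _ _ (Or.inl this.ne'))
    · exact (Real.Gamma_integrand_isLittleO (a.re - 1)).isBigO
  refine hr.mono' (ContinuousOn.aestronglyMeasurable (fun t ht => ?_) measurableSet_Ioi) ?_
  · have : 0 < t := hx.trans ht
    refine (ContinuousAt.mul ?_ (by fun_prop)).continuousWithinAt
    exact continuousAt_ofReal_cpow_const _ _ (Or.inr this.ne')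
  · refine (ae_restrict_mem measurableSet_Ioi).mono fun t ht => ?_
    simp [norm_cpow_eq_rpow_re_of_pos (hx.trans ht), norm_exp, mul_comm]

theorem integral_gammaIntegrand_Ioi_exp (a : ℂ) (L : ℝ) :
    ∫ t in Ioi (Real.exp L), (t : ℂ) ^ (a - 1) * exp (-(t : ℂ)) =
      ∫ u in Ioi L, exp (a * (u : ℂ) - exp (u : ℂ)) := by
  rw [← integral_comp_exp_Ioi]
  refine setIntegral_congr_fun measurableSet_Ioi fun u _ => ?_
  simp only [real_smul, ofReal_exp]
  rw [cpow_def_of_ne_zero (exp_ne_zero _), ← ofReal_exp, ← ofReal_log (Real.exp_pos _).le,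
    Real.log_exp, ofReal_exp, ← exp_add, ← exp_add]
  congr 1
  ring

theorem integrableOn_exp_mul_sub_exp_Ioi (a : ℂ) (L : ℝ) :
    IntegrableOn (fun u : ℝ => exp (a * (u : ℂ) - exp (u : ℂ))) (Ioi L) := by
  have := (integrableOn_comp_exp_Ioi _ L).2 (integrableOn_gammaIntegrand_Ioi a (Real.exp_pos L))
  refine this.congr_fun (fun u _ => ?_) measurableSet_Ioi
  simp only [real_smul, ofReal_exp]
  rw [cpow_def_of_ne_zero (exp_ne_zero _), ← ofReal_exp, ← ofReal_log (Real.exp_pos _).le,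
    Real.log_exp, ofReal_exp, ← exp_add, ← exp_add]
  congr 1
  ring

/-- In the coordinate `u = log t` the integrand `exp (a u - e^u)` is entire, so it has a primitive
`P`. Arc and half-line together then give a constant minus `P ℓ`. -/
theorem hasDerivAt_upperIncompleteGamma (a ℓ : ℂ) :
    HasDerivAt (upperIncompleteGamma a) (-exp (a * ℓ - exp ℓ)) ℓ := by
  obtain ⟨P, hP⟩ := (show Differentiable ℂ (fun z => exp (a * z - exp z)) by
    fun_prop).isExactOn_univ
  replace hP : ∀ z, HasDerivAt P (exp (a * z - exp z)) z := fun z => hP z trivial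
  have key : upperIncompleteGamma a = fun ℓ =>
      ((∫ u in Ioi (0 : ℝ), exp (a * (u : ℂ) - exp (u : ℂ))) + P 0) - P ℓ := by
    funext z
    rw [upperIncompleteGamma, integral_gammaIntegrand_Ioi_exp]
    have h1 : (∫ v in z.im..0, exp (a * (z.re + v * I) - exp (z.re + v * I)) * I) =
        P z.re - P z := by
      rw [intervalIntegral.integral_eq_sub_of_hasDerivAt (f := fun v : ℝ => P (z.re + v * I))]
      · simp [re_add_im]
      · intro v _
        have hv : HasDerivAt (fun v : ℝ => (z.re : ℂ) + v * I) I v := by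
          simpa using ((hasDerivAt_id v).ofReal_comp.mul_const I).const_add (z.re : ℂ)
        exact (hP _).comp v hv
      · exact Continuous.intervalIntegrable (by fun_prop) _ _
    have h2 : (∫ u in (0 : ℝ)..z.re, exp (a * (u : ℂ) - exp (u : ℂ))) = P z.re - P 0 := by
      rw [intervalIntegral.integral_eq_sub_of_hasDerivAt (f := fun u : ℝ => P u)]
      · simp
      · intro u _
        exact (hP _).comp_ofReal
      · exact Continuous.intervalIntegrable (by fun_prop) _ _
    have h3 := intervalIntegral.integral_interval_add_Ioi
      (integrableOn_exp_mul_sub_exp_Ioi a 0) (integrableOn_exp_mul_sub_exp_Ioi a z.re)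
    rw [h1, ← h3, h2]
    ring
  rw [key]
  exact (hP ℓ).const_sub _

theorem norm_upperIncompleteGamma_sub_le (a ℓ : ℂ) (hℓ : |ℓ.im| ≤ Real.pi) :
    ‖upperIncompleteGamma a ℓ -
        ∫ t in Ioi (Real.exp ℓ.re), (t : ℂ) ^ (a - 1) * exp (-(t : ℂ))‖ ≤
      Real.exp (a.re * ℓ.re + |a.im| * Real.pi - Real.exp ℓ.re * Real.cos ℓ.im) * Real.pi := by
  rw [upperIncompleteGamma, add_sub_cancel_right]
  refine (intervalIntegral.norm_integral_le_of_norm_le_const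
    (C := Real.exp (a.re * ℓ.re + |a.im| * Real.pi - Real.exp ℓ.re * Real.cos ℓ.im)) ?_).trans ?_
  · intro v hv
    have hv' : |v| ≤ |ℓ.im| := by
      have := abs_sub_right_of_mem_uIcc (uIoc_subset_uIcc hv)
      simpa using this
    -- On the arc, `Re t = |x| cos v`, and the cosine decreases in `|v|` up to `π`, so `e^(-t)` is
    -- largest in norm at the starting point `x`.
    have hcos : Real.cos ℓ.im ≤ Real.cos v := by
      rw [← Real.cos_abs ℓ.im, ← Real.cos_abs v]
      exact Real.cos_le_cos_of_nonneg_of_le_pi (abs_nonneg _) hℓ hv'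
    rw [norm_mul, norm_I, mul_one, norm_exp]
    apply Real.exp_le_exp.2
    have e1 : (exp ((ℓ.re : ℂ) + v * I)).re = Real.exp ℓ.re * Real.cos v := by
      rw [exp_re]; simp
    have e2 : (a * ((ℓ.re : ℂ) + v * I)).re = a.re * ℓ.re - a.im * v := by
      simp
    rw [sub_re, e1, e2]
    have h1 : -(a.im * v) ≤ |a.im| * Real.pi := by
      calc -(a.im * v) ≤ |a.im * v| := neg_le_abs _
        _ = |a.im| * |v| := abs_mul _ _
        _ ≤ _ := by gcongr; exact hv'.trans hℓ
    have h2 := mul_le_mul_of_nonneg_left hcos (Real.exp_pos ℓ.re).le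
    linarith
  · gcongr
    simpa using hℓ

theorem tendsto_upperIncompleteGamma_add_atTop (a ℓ : ℂ) (hℓ : |ℓ.im| < Real.pi / 2) :
    Tendsto (fun t : ℝ => upperIncompleteGamma a (ℓ + t)) atTop (𝓝 0) := by
  have hcos : 0 < Real.cos ℓ.im := Real.cos_pos_of_mem_Ioo (abs_lt.1 hℓ)
  have hexp : Tendsto (fun t : ℝ => Real.exp (ℓ.re + t)) atTop atTop :=
    Real.tendsto_exp_atTop.comp (tendsto_atTop_add_const_left _ _ tendsto_id)
  have h1 : Tendsto (fun t : ℝ => ∫ t in Ioi (Real.exp (ℓ.re + t)),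
      (t : ℂ) ^ (a - 1) * exp (-(t : ℂ))) atTop (𝓝 0) := by
    have h0 := integrableOn_gammaIntegrand_Ioi a one_pos
    have := intervalIntegral_tendsto_integral_Ioi 1 h0 hexp
    have := (tendsto_const_nhds (x := ∫ t in Ioi (1 : ℝ),
      (t : ℂ) ^ (a - 1) * exp (-(t : ℂ)))).sub this
    rw [sub_self] at this
    refine this.congr fun t => ?_
    rw [← intervalIntegral.integral_interval_add_Ioi h0
      (integrableOn_gammaIntegrand_Ioi a (Real.exp_pos (ℓ.re + t))), add_sub_cancel_left]
  have h2 : Tendsto (fun t : ℝ => Real.exp (a.re * (ℓ.re + t) + |a.im| * Real.pi -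
      Real.exp (ℓ.re + t) * Real.cos ℓ.im) * Real.pi) atTop (𝓝 0) := by
    have h3 : Tendsto (fun x : ℝ => x ^ a.re * Real.exp (-Real.cos ℓ.im * x)) atTop (𝓝 0) :=
      tendsto_rpow_mul_exp_neg_mul_atTop_nhds_zero _ _ hcos
    have h4 := ((h3.comp hexp).mul_const (Real.exp (|a.im| * Real.pi))).mul_const Real.pi
    simp only [zero_mul] at h4
    refine h4.congr fun t => ?_
    simp only [Function.comp]
    rw [Real.rpow_def_of_pos (Real.exp_pos _), Real.log_exp, ← Real.exp_add, ← Real.exp_add]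
    congr 2
    ring
  have h5 := squeeze_zero_norm (fun t : ℝ => by
    simpa using norm_upperIncompleteGamma_sub_le a (ℓ + t) (by
      simp only [add_im, ofReal_im, add_zero]; linarith [Real.pi_pos])) h2
  simpa using h5.add h1

/-- As `x → 0` the half-line integral fills up Euler's integral, while the arc contributes
`O(|x|^(Re a))`. -/
theorem tendsto_upperIncompleteGamma_add_atBot {a : ℂ} (ha : 0 < a.re) (ℓ : ℂ)
    (hℓ : |ℓ.im| ≤ Real.pi) :
    Tendsto (fun t : ℝ => upperIncompleteGamma a (ℓ + t)) atBot (𝓝 (Gamma a)) := by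
  have hexp : Tendsto (fun t : ℝ => Real.exp (ℓ.re + t)) atBot (𝓝 0) :=
    Real.tendsto_exp_atBot.comp (tendsto_atBot_add_const_left _ _ tendsto_id)
  have h1 : Tendsto (fun t : ℝ => ∫ t in Ioi (Real.exp (ℓ.re + t)),
      (t : ℂ) ^ (a - 1) * exp (-(t : ℂ))) atBot (𝓝 (Gamma a)) := by
    have h0 : IntegrableOn (fun t : ℝ => (t : ℂ) ^ (a - 1) * exp (-(t : ℂ))) (Ioi 0) :=
      (GammaIntegral_convergent ha).congr_fun (fun t _ => by simp [mul_comm]) measurableSet_Ioi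
    have hG : Gamma a = ∫ t in Ioi (0 : ℝ), (t : ℂ) ^ (a - 1) * exp (-(t : ℂ)) := by
      rw [Gamma_eq_integral ha, GammaIntegral]
      exact setIntegral_congr_fun measurableSet_Ioi (fun t _ => by simp [mul_comm])
    have hc : Tendsto (fun t : ℝ => ∫ t in (0 : ℝ)..(Real.exp (ℓ.re + t)),
      (t : ℂ) ^ (a - 1) * exp (-(t : ℂ))) atBot (𝓝 0) := by
      have hint : IntervalIntegrable (fun t : ℝ => (t : ℂ) ^ (a - 1) * exp (-(t : ℂ)))
          volume 0 1 := by
        rw [intervalIntegrable_iff_integrableOn_Ioc_of_le zero_le_one]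
        exact h0.mono_set Ioc_subset_Ioi_self
      have hco := intervalIntegral.continuousOn_primitive_interval' hint (left_mem_uIcc)
      have := (hco 0 left_mem_uIcc).tendsto
      rw [intervalIntegral.integral_same] at this
      refine this.comp (tendsto_nhdsWithin_iff.2 ⟨hexp, ?_⟩)
      filter_upwards [hexp.eventually (gt_mem_nhds one_pos)] with t ht
      rw [uIcc_of_le zero_le_one]
      exact ⟨(Real.exp_pos _).le, ht.le⟩
    have := (tendsto_const_nhds (x := Gamma a)).sub hc
    rw [sub_zero] at this
    refine this.congr fun t => ?_
    rw [hG, ← intervalIntegral.integral_interval_add_Ioi h0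
      (integrableOn_gammaIntegrand_Ioi a (Real.exp_pos (ℓ.re + t))), add_sub_cancel_left]
  have h2 : Tendsto (fun t : ℝ => Real.exp (a.re * (ℓ.re + t) + |a.im| * Real.pi -
      Real.exp (ℓ.re + t) * Real.cos ℓ.im) * Real.pi) atBot (𝓝 0) := by
    rw [← zero_mul Real.pi]
    refine Tendsto.mul_const _ (Real.tendsto_exp_atBot.comp ?_)
    have h3 : Tendsto (fun t : ℝ => a.re * (ℓ.re + t)) atBot atBot :=
      (tendsto_atBot_add_const_left _ _ tendsto_id).const_mul_atBot ha
    have h4 := (hexp.mul_const (Real.cos ℓ.im)).const_sub (|a.im| * Real.pi)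
    refine (h3.atBot_add h4).congr fun t => ?_
    ring
  have h5 := squeeze_zero_norm (fun t : ℝ => by
    simpa using norm_upperIncompleteGamma_sub_le a (ℓ + t) (by simpa using hℓ)) h2
  simpa using h5.add h1

/-! ### The kernel `1/(y + r)` off the negative half-line. -/

/-- Since `-r` is never in the slit plane, `y + r` stays away from `0`, and for large `r` it grows
like `r`. Uniformity near `y` is what differentiation under the integral sign requires. -/
theorem exists_forall_mem_ball_le_norm_add {y : ℂ} (hy : y ∈ slitPlane) :
    ∃ δ : ℝ, 0 < δ ∧ ∀ z ∈ Metric.ball y δ, ∀ r : ℝ, 0 ≤ r → δ * (1 + r) ≤ ‖z + r‖ := by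
  obtain ⟨ε, hε, hball⟩ := Metric.isOpen_iff.1 isOpen_slitPlane y hy
  have h1 : ∀ r : ℝ, 0 ≤ r → ε ≤ ‖y + r‖ := by
    intro r hr
    by_contra! h
    have : -(r : ℂ) ∈ slitPlane := hball (by
      rw [Metric.mem_ball, dist_comm, dist_eq_norm, sub_neg_eq_add]; exact h)
    rw [mem_slitPlane_iff] at this
    simp at this
    linarith
  set K := (1 + ‖y‖) / ε + 1 with hK
  have hK1 : 1 ≤ K := by rw [hK]; linarith [show 0 ≤ (1 + ‖y‖) / ε by positivity]
  have h2 : ∀ r : ℝ, 0 ≤ r → 1 + r ≤ K * ‖y + r‖ := by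
    intro r hr
    have e1 := h1 r hr
    have e2 : r ≤ ‖y + r‖ + ‖y‖ := by
      have := norm_sub_le (y + r) y
      rwa [add_sub_cancel_left, norm_real, Real.norm_of_nonneg hr] at this
    have e3 : (1 + ‖y‖) ≤ (1 + ‖y‖) / ε * ‖y + r‖ := by
      rw [div_mul_eq_mul_div, le_div_iff₀ hε]
      gcongr
    rw [hK]
    linarith
  -- At `y` itself the constant is `1/K`; half of it is given up to pass from `y` to `z`.
  refine ⟨1 / (2 * K), by positivity, fun z hz r hr => ?_⟩
  have h3 := h2 r hr
  rw [Metric.mem_ball, dist_eq_norm] at hz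
  have h4 : ‖y + r‖ ≤ ‖z + r‖ + ‖z - y‖ := by
    have := norm_sub_le (z + r) (z - y)
    rwa [show z + r - (z - y) = y + r by ring] at this
  have h5 : 1 / K * (1 + r) ≤ ‖y + r‖ := by
    rw [one_div_mul_eq_div, div_le_iff₀ (by positivity)]; linarith
  have h6 : 1 / K = 2 * (1 / (2 * K)) := by field_simp
  have h7 : 1 / (2 * K) ≤ 1 / (2 * K) * (1 + r) :=
    le_mul_of_one_le_right (by positivity) (by linarith)
  rw [h6] at h5
  linarith

theorem add_ofReal_ne_zero {y : ℂ} (hy : y ∈ slitPlane) {r : ℝ} (hr : 0 ≤ r) : y + r ≠ 0 := by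
  obtain ⟨δ, hδ, h⟩ := exists_forall_mem_ball_le_norm_add hy
  exact norm_pos_iff.1 (lt_of_lt_of_le (by positivity) (h y (Metric.mem_ball_self hδ) r hr))

theorem continuousOn_inv_add {y : ℂ} (hy : y ∈ slitPlane) :
    ContinuousOn (fun r : ℝ => (y + r)⁻¹) (Ici 0) := fun _ hr =>
  (ContinuousAt.inv₀ (f := fun r : ℝ => y + (r : ℂ)) (by fun_prop)
    (add_ofReal_ne_zero hy hr)).continuousWithinAt

theorem exists_norm_inv_add_le {y : ℂ} (hy : y ∈ slitPlane) :
    ∃ C : ℝ, 0 < C ∧ ∀ r : ℝ, 0 ≤ r → ‖(y + r)⁻¹‖ ≤ C * (1 + r)⁻¹ := by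
  obtain ⟨δ, hδ, h⟩ := exists_forall_mem_ball_le_norm_add hy
  refine ⟨δ⁻¹, by positivity, fun r hr => ?_⟩
  rw [norm_inv, ← mul_inv]
  exact inv_anti₀ (by positivity) (h y (Metric.mem_ball_self hδ) r hr)

theorem exists_norm_inv_add_le_const {y : ℂ} (hy : y ∈ slitPlane) :
    ∃ C : ℝ, 0 < C ∧ ∀ r : ℝ, 0 ≤ r → ‖(y + r)⁻¹‖ ≤ C := by
  obtain ⟨C, hC, h⟩ := exists_norm_inv_add_le hy
  refine ⟨C, hC, fun r hr => (h r hr).trans ?_⟩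
  exact mul_le_of_le_one_right hC.le (inv_le_one_of_one_le₀ (by linarith))

theorem IntegrableOn.mul_inv_add {F : ℝ → ℂ} (hF : IntegrableOn F (Ioi 0)) {y : ℂ}
    (hy : y ∈ slitPlane) : IntegrableOn (fun r : ℝ => F r * (y + r)⁻¹) (Ioi 0) := by
  obtain ⟨C, hC, h⟩ := exists_norm_inv_add_le_const hy
  refine hF.mul_bdd (c := C) ?_ ?_
  · exact ((continuousOn_inv_add hy).mono Ioi_subset_Ici_self).aestronglyMeasurable
      measurableSet_Ioi
  · exact (ae_restrict_mem measurableSet_Ioi).mono fun r hr => h r (le_of_lt hr)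

theorem hasDerivAt_integral_mul_inv_add {F : ℝ → ℂ} (hF : IntegrableOn F (Ioi 0)) {y : ℂ}
    (hy : y ∈ slitPlane) :
    HasDerivAt (fun z : ℂ => ∫ r in Ioi (0 : ℝ), F r * (z + r)⁻¹)
      (∫ r in Ioi (0 : ℝ), -(F r * (y + r)⁻¹ * (y + r)⁻¹)) y := by
  obtain ⟨δ, hδ, h⟩ := exists_forall_mem_ball_le_norm_add hy
  have hne : ∀ z ∈ Metric.ball y δ, ∀ r : ℝ, 0 ≤ r → z + r ≠ 0 := fun z hz r hr =>
    norm_pos_iff.1 (lt_of_lt_of_le (by positivity) (h z hz r hr))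
  refine (hasDerivAt_integral_of_dominated_loc_of_deriv_le (s := Metric.ball y δ ∩ slitPlane)
    (bound := fun r => ‖F r‖ * (δ⁻¹ * δ⁻¹))
    (F' := fun z r => -(F r * (z + r)⁻¹ * (z + r)⁻¹))
    (inter_mem (Metric.ball_mem_nhds y hδ) (isOpen_slitPlane.mem_nhds hy)) ?_ ?_ ?_ ?_ ?_ ?_).2
  · filter_upwards [isOpen_slitPlane.mem_nhds hy] with z hz
    exact (IntegrableOn.mul_inv_add hF hz).aestronglyMeasurable
  · exact IntegrableOn.mul_inv_add hF hy
  · exact (IntegrableOn.mul_inv_add (IntegrableOn.mul_inv_add hF hy) hy).neg.aestronglyMeasurable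
  · refine (ae_restrict_mem measurableSet_Ioi).mono fun r hr z hz => ?_
    have hb : ‖(z + r)⁻¹‖ ≤ δ⁻¹ := by
      rw [norm_inv]
      refine inv_anti₀ hδ (le_trans ?_ (h z hz.1 r (le_of_lt hr)))
      exact le_mul_of_one_le_right hδ.le (by linarith [mem_Ioi.1 hr])
    rw [norm_neg, norm_mul, norm_mul, mul_assoc]
    gcongr
  · exact hF.norm.mul_const _
  · refine (ae_restrict_mem measurableSet_Ioi).mono fun r hr z hz => ?_
    have h0 := hne z hz.1 r (le_of_lt hr)
    have := (((hasDerivAt_id z).add_const (r : ℂ)).inv h0).const_mul (F r)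
    refine this.congr_deriv ?_
    simp only [id]
    field_simp

/-! ### The Gamma integral along rays and the Stieltjes representation. -/

theorem integrableOn_cpow_mul_exp_neg_mul {w c : ℂ} (hw : 0 < w.re) (hc : 0 < c.re) :
    IntegrableOn (fun r : ℝ => (r : ℂ) ^ (w - 1) * exp (-(c * r))) (Ioi 0) := by
  have hr : IntegrableOn (fun t : ℝ => t ^ (w.re - 1) * Real.exp (-c.re * t)) (Ioi 0) := by
    simpa using integrableOn_rpow_mul_exp_neg_mul_rpow (s := w.re - 1) (p := 1) (by linarith)
      one_pos hc
  refine hr.mono' (ContinuousOn.aestronglyMeasurable (fun t ht => ?_) measurableSet_Ioi) ?_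
  · exact (ContinuousAt.mul (continuousAt_ofReal_cpow_const _ _ (Or.inr (ne_of_gt ht)))
      (by fun_prop)).continuousWithinAt
  · refine (ae_restrict_mem measurableSet_Ioi).mono fun t ht => ?_
    simp [norm_cpow_eq_rpow_re_of_pos ht, norm_exp]

theorem norm_cpow_mul_exp_neg_mul (w c : ℂ) {r : ℝ} (hr : 0 < r) :
    ‖(r : ℂ) ^ (w - 1) * exp (-(c * r))‖ = r ^ (w.re - 1) * Real.exp (-(c.re * r)) := by
  simp [norm_cpow_eq_rpow_re_of_pos hr, norm_exp]

/-- The Gamma integral along a ray in the open right half-plane. -/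
theorem integral_cpow_mul_exp_neg_mul_Ioi_of_re_pos {w c : ℂ} (hw : 0 < w.re) (hc : 0 < c.re) :
    ∫ r in Ioi (0 : ℝ), (r : ℂ) ^ (w - 1) * exp (-(c * r)) = c ^ (-w) * Gamma w := by
  have hU : IsOpen {z : ℂ | 0 < z.re} := isOpen_lt continuous_const continuous_re
  refine eqOn_of_eq_ofReal_pos (U := {z : ℂ | 0 < z.re})
    (f := fun c => ∫ r in Ioi (0 : ℝ), (r : ℂ) ^ (w - 1) * exp (-(c * r)))
    (g := fun c => c ^ (-w) * Gamma w) hU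
    (convex_halfSpace_re_gt 0).isPreconnected (by simp) ?_ ?_ ?_ hc
  · intro b (hb : 0 < b.re)
    refine DifferentiableAt.differentiableWithinAt ?_
    have hb2 : 0 < b.re / 2 := by positivity
    have hre : ∀ z ∈ Metric.ball b (b.re / 2), b.re / 2 < z.re := by
      intro z hz
      rw [Metric.mem_ball, dist_eq_norm] at hz
      have := (abs_re_le_norm (z - b)).trans_lt hz
      rw [sub_re] at this
      linarith [(abs_lt.1 this).1]
    refine (hasDerivAt_integral_of_dominated_loc_of_deriv_le (s := Metric.ball b (b.re / 2))
      (F := fun z (r : ℝ) => (r : ℂ) ^ (w - 1) * exp (-(z * r)))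
      (F' := fun z (r : ℝ) => (r : ℂ) ^ (w - 1) * (exp (-(z * r)) * -r))
      -- The derivative in `z` brings down a factor `-r`, hence `w + 1`; on the ball the decay rate
      -- exceeds `Re b / 2`.
      (bound := fun r : ℝ => ‖(r : ℂ) ^ (w + 1 - 1) * exp (-((b.re / 2 : ℝ) * r))‖)
      (Metric.ball_mem_nhds b hb2) ?_ ?_ ?_ ?_ ?_ ?_).2.differentiableAt
    · filter_upwards [Metric.ball_mem_nhds b hb2] with z hz
      exact (integrableOn_cpow_mul_exp_neg_mul hw (hb2.trans (hre z hz))).aestronglyMeasurable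
    · exact integrableOn_cpow_mul_exp_neg_mul hw hb
    · simp_rw [← mul_assoc]
      exact (integrableOn_cpow_mul_exp_neg_mul hw hb).aestronglyMeasurable.mul (by fun_prop)
    · refine (ae_restrict_mem measurableSet_Ioi).mono fun r hr z hz => ?_
      have hr' : 0 < r := hr
      rw [norm_cpow_mul_exp_neg_mul _ _ hr, ← mul_assoc, norm_mul,
        norm_cpow_mul_exp_neg_mul _ _ hr, norm_neg, norm_real, Real.norm_of_nonneg hr'.le,
        mul_right_comm, add_re, one_re, add_sub_right_comm, Real.rpow_add_one hr'.ne', ofReal_re]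
      have := hre z hz
      gcongr
    · exact (integrableOn_cpow_mul_exp_neg_mul (w := w + 1)
        (by simp; linarith) (by simpa using hb)).norm
    · refine ae_of_all _ fun r z _ => ?_
      have := (((hasDerivAt_id z).mul_const (r : ℂ)).neg.cexp).const_mul ((r : ℂ) ^ (w - 1))
      simpa using this
  · intro b (hb : 0 < b.re)
    have : b ∈ slitPlane := Or.inl hb
    exact ((differentiableAt_id.cpow_const this).mul_const _).differentiableWithinAt
  · intro t ht
    have := integral_cpow_mul_exp_neg_mul_Ioi hw ht
    simp only [this]
    rw [cpow_neg, one_div, inv_cpow]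
    rw [arg_ofReal_of_nonneg ht.le]
    exact Real.pi_pos.ne

/-- Integrate the derivative of `r^w e^(-cr) / (y+r)`, which vanishes at both ends. The result is a
first-order linear differential equation in `y` for the Stieltjes integral, its second integral
being the derivative of the first. -/
theorem integral_cpow_mul_exp_neg_mul_inv_add_relation {w c y : ℂ} (hw : 0 < w.re) (hc : 0 < c.re)
    (hy : y ∈ slitPlane) :
    (c * y - (1 - w)) * (∫ r in Ioi (0 : ℝ), (r : ℂ) ^ (w - 1) * exp (-(c * r)) * (y + r)⁻¹)
      - y * (∫ r in Ioi (0 : ℝ), -((r : ℂ) ^ (w - 1) * exp (-(c * r)) * (y + r)⁻¹ * (y + r)⁻¹))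
      = c * (c ^ (-w) * Gamma w) := by
  set f : ℝ → ℂ := fun r => (r : ℂ) ^ (w - 1) * exp (-(c * r)) with hf
  have hf0 : IntegrableOn f (Ioi 0) := integrableOn_cpow_mul_exp_neg_mul hw hc
  have hf1 := IntegrableOn.mul_inv_add hf0 hy
  have hf2 := IntegrableOn.mul_inv_add hf1 hy
  have hG : ∫ r in Ioi (0 : ℝ), f r = c ^ (-w) * Gamma w :=
    integral_cpow_mul_exp_neg_mul_Ioi_of_re_pos hw hc
  have hw0 : w ≠ 0 := by rintro rfl; simp at hw
  have i1 : Integrable (fun r : ℝ => (c * y - (1 - w)) * (f r * (y + r)⁻¹))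
    (volume.restrict (Ioi 0)) := hf1.const_mul _
  have i2 : Integrable (fun r : ℝ => y * -(f r * (y + r)⁻¹ * (y + r)⁻¹))
    (volume.restrict (Ioi 0)) := hf2.neg.const_mul _
  have i3 : Integrable (fun r : ℝ => c * f r) (volume.restrict (Ioi 0)) := hf0.const_mul _
  have i12 : Integrable (fun r : ℝ => (c * y - (1 - w)) * (f r * (y + r)⁻¹) -
      y * -(f r * (y + r)⁻¹ * (y + r)⁻¹)) (volume.restrict (Ioi 0)) := i1.sub i2
  have hint : Integrable (fun r : ℝ => (c * y - (1 - w)) * (f r * (y + r)⁻¹) -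
      y * -(f r * (y + r)⁻¹ * (y + r)⁻¹) - c * f r) (volume.restrict (Ioi 0)) :=
    (i1.sub i2).sub i3
  have key : ∫ r in Ioi (0 : ℝ), ((c * y - (1 - w)) * (f r * (y + r)⁻¹) -
      y * -(f r * (y + r)⁻¹ * (y + r)⁻¹) - c * f r) = 0 := by
    have := integral_Ioi_of_hasDerivAt_of_tendsto (a := (0 : ℝ)) (m := (0 : ℂ))
      (f := fun r : ℝ => (r : ℂ) ^ w * exp (-(c * r)) * (y + r)⁻¹) ?_ ?_ hint ?_
    · rw [this]
      simp [hw0]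
    · refine ContinuousWithinAt.mul (ContinuousAt.continuousWithinAt ?_)
        (continuousOn_inv_add hy 0 self_mem_Ici)
      exact ContinuousAt.mul (continuousAt_ofReal_cpow_const _ _ (Or.inl hw)) (by fun_prop)
    · intro r hr
      have hr' : (r : ℂ) ≠ 0 := ofReal_ne_zero.2 (ne_of_gt hr)
      have hne := add_ofReal_ne_zero hy (le_of_lt hr)
      have hsl : (r : ℂ) ∈ slitPlane := Or.inl (by simpa using hr)
      have d1 : HasDerivAt (fun z : ℂ => z ^ w * exp (-(c * z)) * (y + z)⁻¹)
          ((w * (r : ℂ) ^ (w - 1) * 1 * exp (-(c * r)) + (r : ℂ) ^ w * (exp (-(c * r)) * -(c * 1)))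
            * (y + r)⁻¹ + (r : ℂ) ^ w * exp (-(c * r)) * (-1 / (y + r) ^ 2)) (r : ℂ) :=
        (((hasDerivAt_id (r : ℂ)).cpow_const hsl).mul
          (((hasDerivAt_id (r : ℂ)).const_mul c).neg.cexp)).mul
          (((hasDerivAt_id (r : ℂ)).const_add y).inv hne)
      refine d1.comp_ofReal.congr_deriv ?_
      have e : (r : ℂ) ^ w = r ^ (w - 1) * r := by
        nth_rw 3 [← cpow_one (r : ℂ)]
        rw [← cpow_add _ _ hr']; simp
      rw [e, hf]
      field_simp
      ring
    · obtain ⟨C, hC, h⟩ := exists_norm_inv_add_le_const hy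
      have h3 := (tendsto_rpow_mul_exp_neg_mul_atTop_nhds_zero w.re c.re hc).mul_const C
      rw [zero_mul] at h3
      refine squeeze_zero_norm' ?_ h3
      filter_upwards [eventually_gt_atTop 0] with r hr
      rw [norm_mul, norm_mul, norm_cpow_eq_rpow_re_of_pos hr, norm_exp]
      have e : (-(c * (r : ℂ))).re = -c.re * r := by simp
      rw [e]
      gcongr
      exact h r hr.le
  rw [integral_sub i12 i3, integral_sub i1 i2, integral_const_mul, integral_const_mul,
    integral_const_mul, hG] at key
  exact sub_eq_zero.1 key

/-- Stieltjes representation of the incomplete gamma function, along a ray in the right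
half-plane. -/
theorem upperIncompleteGamma_mul_exp_mul_Gamma {w c y : ℂ} (hw : 0 < w.re) (hc : 0 < c.re)
    (hy : y ∈ slitPlane) :
    upperIncompleteGamma (1 - w) (log c + log y) * exp (c * y) * Gamma w =
      y ^ (1 - w) * ∫ r in Ioi (0 : ℝ), (r : ℂ) ^ (w - 1) * exp (-(c * r)) * (y + r)⁻¹ := by
  have hc0 : c ≠ 0 := by rintro rfl; simp at hc
  have hf0 := integrableOn_cpow_mul_exp_neg_mul hw hc
  set E : ℂ → ℂ := fun y => upperIncompleteGamma (1 - w) (log c + log y) * Gamma w -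
    exp (-(c * y)) * (y ^ (1 - w) *
      ∫ r in Ioi (0 : ℝ), (r : ℂ) ^ (w - 1) * exp (-(c * r)) * (y + r)⁻¹) with hE
  -- By the differential equation of the Stieltjes integral, both terms of `E` have derivative
  -- `-c^(1-w) Γ(w) z^(-w) e^(-cz)`.
  have hderiv : ∀ z ∈ slitPlane, HasDerivAt E 0 z := by
    intro z hz
    have hz0 := slitPlane_ne_zero hz
    have hrel := integral_cpow_mul_exp_neg_mul_inv_add_relation hw hc hz
    have dJ := hasDerivAt_integral_mul_inv_add hf0 hz
    have d1 := ((hasDerivAt_upperIncompleteGamma (1 - w) (log c + log z)).comp z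
      ((hasDerivAt_log hz).const_add (log c))).mul_const (Gamma w)
    have d2 := (((hasDerivAt_id z).const_mul c).neg.cexp).mul
      (((hasDerivAt_id z).cpow_const (c := 1 - w) hz).mul dJ)
    refine (d1.sub d2).congr_deriv ?_
    simp only [id, Pi.mul_apply, Pi.neg_apply]
    set J := ∫ r in Ioi (0 : ℝ), (r : ℂ) ^ (w - 1) * exp (-(c * r)) * (z + r)⁻¹
    set J' := ∫ r in Ioi (0 : ℝ), -((r : ℂ) ^ (w - 1) * exp (-(c * r)) * (z + r)⁻¹ * (z + r)⁻¹)
    have e1 : exp ((1 - w) * (log c + log z) - exp (log c + log z)) =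
        c * c ^ (-w) * z ^ (1 - w) * exp (-(c * z)) := by
      rw [exp_add (log c), exp_log hc0, exp_log hz0, sub_eq_add_neg, exp_add, mul_add, exp_add,
        cpow_def_of_ne_zero hz0, mul_comm (log z), cpow_def_of_ne_zero hc0, sub_mul, one_mul,
        sub_eq_add_neg, exp_add, exp_log hc0, mul_comm (log c), neg_mul]
    have e2 : z ^ (1 - w) = z ^ (1 - w - 1) * z := by
      nth_rw 3 [← cpow_one z]
      rw [← cpow_add _ _ hz0, sub_add_cancel]
    rw [e1, e2, show -(c * c ^ (-w) * (z ^ (1 - w - 1) * z) * exp (-(c * z))) * z⁻¹ * Gamma w =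
      -(c * (c ^ (-w) * Gamma w)) * (z ^ (1 - w - 1) * exp (-(c * z))) by field_simp, ← hrel]
    ring
  -- The slit plane is connected, so the constant `E` can be evaluated by letting `t → +∞` on the
  -- positive half-line, where `|arg (ct)| < π/2` makes both terms vanish.
  have hconst : ∀ t : ℝ, 0 < t → E y = E t := by
    intro t ht
    have hpre : IsPreconnected slitPlane :=
      (starConvex_one_slitPlane.isPathConnected one_mem_slitPlane).isConnected.isPreconnected
    exact isOpen_slitPlane.is_const_of_deriv_eq_zero hpre
      (fun z hz => (hderiv z hz).differentiableAt.differentiableWithinAt)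
      (fun z hz => (hderiv z hz).deriv) hy (Or.inl (by simpa using ht))
  have harg : |(log c).im| < Real.pi / 2 := by
    rw [log_im]; exact abs_arg_lt_pi_div_two_iff.2 (Or.inl hc)
  have hlim : Tendsto (fun t : ℝ => E t) atTop (𝓝 0) := by
    have l1 : Tendsto (fun t : ℝ => upperIncompleteGamma (1 - w) (log c + log t) * Gamma w)
        atTop (𝓝 0) := by
      have := ((tendsto_upperIncompleteGamma_add_atTop (1 - w) (log c) harg).comp
        Real.tendsto_log_atTop).mul_const (Gamma w)
      rw [zero_mul] at this
      refine this.congr' ?_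
      filter_upwards [eventually_gt_atTop 0] with t ht
      simp [ofReal_log ht.le]
    have l2 : Tendsto (fun t : ℝ => exp (-(c * t)) * ((t : ℂ) ^ (1 - w) *
        ∫ r in Ioi (0 : ℝ), (r : ℂ) ^ (w - 1) * exp (-(c * r)) * ((t : ℂ) + r)⁻¹))
        atTop (𝓝 0) := by
      set A := ∫ r in Ioi (0 : ℝ), ‖(r : ℂ) ^ (w - 1) * exp (-(c * r))‖
      have h3 := (tendsto_rpow_mul_exp_neg_mul_atTop_nhds_zero (1 - w.re) c.re hc).mul_const A
      rw [zero_mul] at h3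
      refine squeeze_zero_norm' ?_ h3
      filter_upwards [eventually_ge_atTop 1] with t ht
      have ht0 : 0 < t := by linarith
      rw [norm_mul, norm_mul, norm_cpow_eq_rpow_re_of_pos ht0, norm_exp, ← mul_assoc,
        mul_comm (Real.exp _)]
      have e : (-(c * (t : ℂ))).re = -c.re * t := by simp
      rw [e, sub_re, one_re]
      gcongr
      refine norm_integral_le_of_norm_le hf0.norm ?_
      refine (ae_restrict_mem measurableSet_Ioi).mono fun r hr => ?_
      rw [norm_mul _ (((t : ℂ) + r)⁻¹)]
      refine mul_le_of_le_one_right (norm_nonneg _) ?_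
      rw [norm_inv, ← ofReal_add, norm_real, Real.norm_of_nonneg (by linarith [mem_Ioi.1 hr])]
      exact inv_le_one_of_one_le₀ (by linarith [mem_Ioi.1 hr])
    simpa using l1.sub l2
  have hzero : E y = 0 := by
    refine tendsto_nhds_unique (tendsto_const_nhds.congr' ?_) hlim
    filter_upwards [eventually_gt_atTop 0] with t ht
    exact hconst t ht
  have := sub_eq_zero.1 hzero
  rw [mul_right_comm, this, mul_comm, ← mul_assoc, ← exp_add]
  simp

/-! ### The Mellin transform of `1/(y + r)`. -/

theorem mellinConvergent_inv_add {y : ℂ} (hy : y ∈ slitPlane) {w : ℂ} (h0 : 0 < w.re)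
    (h1 : w.re < 1) : MellinConvergent (fun r : ℝ => (y + r)⁻¹) w := by
  obtain ⟨C, hC, h⟩ := exists_norm_inv_add_le hy
  refine mellinConvergent_of_isBigO_rpow (a := 1) (b := 0) ?_ ?_ h1 ?_ h0
  · exact ((continuousOn_inv_add hy).mono Ioi_subset_Ici_self).locallyIntegrableOn
      measurableSet_Ioi
  · refine IsBigO.of_bound C ?_
    filter_upwards [eventually_gt_atTop 0] with r hr
    refine (h r hr.le).trans ?_
    rw [Real.rpow_neg_one, Real.norm_of_nonneg (by positivity)]
    gcongr
    linarith
  · refine IsBigO.of_bound C ?_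
    filter_upwards [self_mem_nhdsWithin] with r hr
    refine (h r (le_of_lt hr)).trans ?_
    simp only [neg_zero, Real.rpow_zero, norm_one]
    gcongr
    exact inv_le_one_of_one_le₀ (by linarith [mem_Ioi.1 hr])

/-- This is the limit of the Stieltjes representation as `c = e^t → 0`: the incomplete gamma
function becomes complete, and the exponential in the integral tends to `1`. -/
theorem cpow_mul_mellin_inv_add {y : ℂ} (hy : y ∈ slitPlane) {w : ℂ} (h0 : 0 < w.re)
    (h1 : w.re < 1) :
    y ^ (1 - w) * mellin (fun r : ℝ => (y + r)⁻¹) w = Gamma (1 - w) * Gamma w := by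
  have hint := mellinConvergent_inv_add hy h0 h1
  have hE : Tendsto (fun t : ℝ => (Real.exp t : ℂ)) atBot (𝓝 0) := by
    exact_mod_cast (continuous_ofReal.tendsto 0).comp Real.tendsto_exp_atBot
  have l1 : Tendsto (fun t : ℝ => upperIncompleteGamma (1 - w) (log y + t) *
      exp ((Real.exp t : ℂ) * y) * Gamma w) atBot (𝓝 (Gamma (1 - w) * Gamma w)) := by
    have := ((tendsto_upperIncompleteGamma_add_atBot (a := 1 - w) (by simpa using h1) (log y)
      (by rw [log_im]; exact abs_arg_le_pi y)).mul
      ((hE.mul_const y).cexp)).mul_const (Gamma w)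
    simpa using this
  have l2 : Tendsto (fun t : ℝ => y ^ (1 - w) * ∫ r in Ioi (0 : ℝ), (r : ℂ) ^ (w - 1) *
      exp (-((Real.exp t : ℂ) * r)) * (y + r)⁻¹) atBot
      (𝓝 (y ^ (1 - w) * mellin (fun r : ℝ => (y + r)⁻¹) w)) := by
    refine Tendsto.const_mul _ ?_
    rw [mellin]
    refine tendsto_integral_filter_of_dominated_convergence
      (fun r : ℝ => ‖(r : ℂ) ^ (w - 1) • (y + r)⁻¹‖) ?_ ?_ hint.norm ?_
    · refine .of_forall fun t => ?_
      exact (IntegrableOn.mul_inv_add (integrableOn_cpow_mul_exp_neg_mul h0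
        (by rw [ofReal_re]; exact Real.exp_pos t)) hy).aestronglyMeasurable
    · refine .of_forall fun t => (ae_restrict_mem measurableSet_Ioi).mono fun r hr => ?_
      rw [norm_mul, norm_mul, norm_smul]
      gcongr
      refine mul_le_of_le_one_right (norm_nonneg _) ?_
      rw [← ofReal_mul, ← ofReal_neg, norm_exp_ofReal]
      have : 0 < Real.exp t * r := mul_pos (Real.exp_pos t) hr
      exact Real.exp_le_one_iff.2 (by linarith)
    · refine (ae_restrict_mem measurableSet_Ioi).mono fun r hr => ?_
      have := (((hE.mul_const (r : ℂ)).neg.cexp).const_mul ((r : ℂ) ^ (w - 1))).mul_const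
        (y + r)⁻¹
      simpa using this
  refine tendsto_nhds_unique l2 (l1.congr fun t => ?_)
  rw [← upperIncompleteGamma_mul_exp_mul_Gamma h0 (by rw [ofReal_re]; exact Real.exp_pos t) hy,
    ← ofReal_log (Real.exp_pos t).le, Real.log_exp, add_comm]

/-! ### The theta series and its Mellin transforms. -/

/-- The half theta series `∑_{n ≥ 1} exp (-π n² z)`, for `0 < Re z`. -/
noncomputable def halfTheta (z : ℂ) : ℂ := (jacobiTheta (I * z) - 1) / 2

theorem hasSum_halfTheta {z : ℂ} (hz : 0 < z.re) :
    HasSum (fun n : ℕ => exp (-(Real.pi * ((n : ℂ) + 1) ^ 2 * z))) (halfTheta z) := by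
  have := hasSum_nat_jacobiTheta (τ := I * z) (by simpa using hz)
  refine this.congr_fun ?_
  intro n
  congr 1
  linear_combination (-(Real.pi : ℂ) * ((n : ℂ) + 1) ^ 2 * z) * I_mul_I

theorem halfTheta_inv {z : ℂ} (hz : 0 < z.re) :
    halfTheta z⁻¹ = z ^ (1 / 2 : ℂ) * halfTheta z + z ^ (1 / 2 : ℂ) / 2 - 1 / 2 := by
  have h := jacobiTheta_S_smul ⟨I * z, by simpa using hz⟩
  have hz0 : z ≠ 0 := by rintro rfl; simp at hz
  rw [UpperHalfPlane.modular_S_smul] at h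
  simp only at h
  have e1 : (-(I * z))⁻¹ = I * z⁻¹ := by
    rw [← neg_inv, mul_inv, inv_I]
    ring
  have e2 : -I * (I * z) = z := by linear_combination (-z) * I_mul_I
  rw [e1, e2] at h
  rw [halfTheta, halfTheta, h]
  ring

theorem continuousOn_halfTheta_mul {c : ℂ} (hc : 0 < c.re) :
    ContinuousOn (fun r : ℝ => halfTheta (c * r)) (Ioi 0) := by
  intro r hr
  have hr' : 0 < r := hr
  have hj : ContinuousAt jacobiTheta (I * (c * r)) :=
    continuousAt_jacobiTheta (by simpa using mul_pos hc hr')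
  have : ContinuousAt (fun r : ℝ => jacobiTheta (I * (c * r))) r :=
    ContinuousAt.comp (f := fun r : ℝ => I * (c * (r : ℂ))) hj (by fun_prop)
  exact ((this.sub continuousAt_const).div_const 2).continuousWithinAt

theorem exp_neg_le_rpow_neg {x β : ℝ} (hx : 0 < x) (hβ : 0 < β) :
    Real.exp (-x) ≤ (x / β) ^ (-β) := by
  have h1 : x / β ≤ Real.exp (x / β) := by linarith [Real.add_one_le_exp (x / β)]
  have h2 : (x / β) ^ β ≤ Real.exp x := by
    calc (x / β) ^ β ≤ Real.exp (x / β) ^ β := by gcongr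
      _ = Real.exp x := by rw [← Real.exp_mul, div_mul_cancel₀ _ hβ.ne']
  rw [Real.exp_neg, Real.rpow_neg (by positivity)]
  exact inv_anti₀ (by positivity) h2

/-- Bounding each exponential by a power leaves `∑ n^(-2β)`, which converges for `β > 1/2`. Varying
`β` controls both ends of the half-line without the modular relation. -/
theorem exists_norm_halfTheta_mul_le {c : ℂ} (hc : 0 < c.re) {β : ℝ} (hβ : 1 / 2 < β) :
    ∃ C : ℝ, ∀ r : ℝ, 0 < r → ‖halfTheta (c * r)‖ ≤ C * r ^ (-β) := by
  have hs : Summable (fun n : ℕ => ((n : ℝ) + 1) ^ (-(2 * β))) := by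
    have := (summable_nat_add_iff 1).2 (Real.summable_nat_rpow.2 (show -(2 * β) < -1 by linarith))
    simpa using this
  have hβ0 : 0 < β := by linarith
  set K := (Real.pi * c.re / β) ^ (-β) with hK
  refine ⟨K * ∑' n : ℕ, ((n : ℝ) + 1) ^ (-(2 * β)), fun r hr => ?_⟩
  have hz : 0 < (c * r).re := by simpa using mul_pos hc hr
  rw [← (hasSum_halfTheta hz).tsum_eq]
  refine tsum_of_norm_bounded ((hs.hasSum.mul_left K).mul_right _) fun n => ?_
  have hpos : 0 < Real.pi * ((n : ℝ) + 1) ^ 2 * (c.re * r) := by positivity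
  have e : (-(Real.pi * ((n : ℂ) + 1) ^ 2 * (c * r))).re =
      -(Real.pi * ((n : ℝ) + 1) ^ 2 * (c.re * r)) := by
    have : -(Real.pi * ((n : ℂ) + 1) ^ 2 * (c * r)) =
      ((-(Real.pi * ((n : ℝ) + 1) ^ 2 * r) : ℝ) : ℂ) * c := by push_cast; ring
    rw [this, re_ofReal_mul]
    ring
  rw [norm_exp, e]
  refine (exp_neg_le_rpow_neg hpos hβ0).trans (le_of_eq ?_)
  rw [show Real.pi * ((n : ℝ) + 1) ^ 2 * (c.re * r) / β =
    Real.pi * c.re / β * ((n : ℝ) + 1) ^ (2 : ℝ) * r by rw [Real.rpow_two]; ring,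
    Real.mul_rpow (by positivity) hr.le, Real.mul_rpow (by positivity) (by positivity),
    ← Real.rpow_mul (by positivity), ← hK]
  congr 3
  ring

theorem mellinConvergent_and_differentiableAt_of_norm_le {f : ℝ → ℂ} {σ : ℝ} {w : ℂ}
    (hf : ContinuousOn f (Ioi 0))
    (hb : ∀ β : ℝ, σ < β → ∃ C : ℝ, ∀ r : ℝ, 0 < r → ‖f r‖ ≤ C * r ^ (-β)) (hw : σ < w.re) :
    MellinConvergent f w ∧ DifferentiableAt ℂ (mellin f) w := by
  have hO : ∀ β : ℝ, σ < β → ∀ᶠ C in atTop, ∀ r : ℝ, 0 < r → ‖f r‖ ≤ C * ‖r ^ (-β)‖ := by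
    intro β hβ
    obtain ⟨C, hC⟩ := hb β hβ
    filter_upwards [eventually_ge_atTop C] with D hD r hr
    refine (hC r hr).trans ?_
    rw [Real.norm_of_nonneg (by positivity)]
    gcongr
  -- An exponent above `Re w` is needed at infinity, and one strictly between `σ` and `Re w` at `0`.
  obtain ⟨C₁, h₁⟩ := (hO (w.re + 1) (by linarith)).exists
  obtain ⟨C₂, h₂⟩ := (hO ((σ + w.re) / 2) (by linarith)).exists
  have hl := hf.locallyIntegrableOn measurableSet_Ioi (μ := volume)
  have ht : f =O[atTop] (· ^ (-(w.re + 1))) := IsBigO.of_bound C₁ <| by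
    filter_upwards [eventually_gt_atTop 0] with r hr using h₁ r hr
  have h0 : f =O[𝓝[>] 0] (· ^ (-((σ + w.re) / 2))) := IsBigO.of_bound C₂ <| by
    filter_upwards [self_mem_nhdsWithin] with r hr using h₂ r hr
  exact ⟨mellinConvergent_of_isBigO_rpow hl ht (by linarith) h0 (by linarith),
    mellin_differentiableAt_of_isBigO_rpow hl ht (by linarith) h0 (by linarith)⟩

theorem mellinConvergent_halfTheta_mul {c : ℂ} (hc : 0 < c.re) {w : ℂ} (hw : 1 / 2 < w.re) :
    MellinConvergent (fun r : ℝ => halfTheta (c * r)) w :=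
  (mellinConvergent_and_differentiableAt_of_norm_le (continuousOn_halfTheta_mul hc)
    (fun _ => exists_norm_halfTheta_mul_le hc) hw).1

theorem mellin_halfTheta_mul_inv_add {c y : ℂ} (hc : 0 < c.re) (hy : y ∈ slitPlane) {w : ℂ}
    (hw : 1 / 2 < w.re) :
    MellinConvergent (fun r : ℝ => halfTheta (c * r) * (y + r)⁻¹) w ∧
      DifferentiableAt ℂ (mellin fun r : ℝ => halfTheta (c * r) * (y + r)⁻¹) w := by
  refine mellinConvergent_and_differentiableAt_of_norm_le (σ := 1 / 2)
    ((continuousOn_halfTheta_mul hc).mul ((continuousOn_inv_add hy).mono Ioi_subset_Ici_self))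
    (fun β hβ => ?_) hw
  obtain ⟨C, hC⟩ := exists_norm_halfTheta_mul_le hc hβ
  obtain ⟨D, hD, hD'⟩ := exists_norm_inv_add_le_const hy
  refine ⟨C * D, fun r hr => ?_⟩
  rw [norm_mul, mul_right_comm]
  exact mul_le_mul (hC r hr) (hD' r hr.le) (norm_nonneg _) ((norm_nonneg _).trans (hC r hr))

/-- Sum and integral may be exchanged because the `n`-th integral of norms is `O(n^(-2 Re w))`. The
multiplier `m` is `1/(y+r)` for the incomplete gamma series and `1` for the zeta function. -/
theorem hasSum_integral_exp_mul {c w : ℂ} (hc : 0 < c.re) (hw : 1 / 2 < w.re) {m : ℝ → ℂ} {C : ℝ}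
    (hm : ContinuousOn m (Ioi 0)) (hC : ∀ r : ℝ, 0 < r → ‖m r‖ ≤ C) :
    HasSum (fun n : ℕ => ∫ r in Ioi (0 : ℝ), (r : ℂ) ^ (w - 1) *
        exp (-((Real.pi * ((n : ℝ) + 1) ^ 2 : ℝ) * c * r)) * m r)
      (mellin (fun r : ℝ => halfTheta (c * r) * m r) w) := by
  have hw0 : 0 < w.re := by linarith
  have hre : ∀ n : ℕ, ((Real.pi * ((n : ℝ) + 1) ^ 2 : ℝ) * c).re =
      Real.pi * ((n : ℝ) + 1) ^ 2 * c.re := fun n => re_ofReal_mul _ _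
  have hcn : ∀ n : ℕ, 0 < ((Real.pi * ((n : ℝ) + 1) ^ 2 : ℝ) * c).re := fun n => by
    rw [hre]; positivity
  have hint := fun n => integrableOn_cpow_mul_exp_neg_mul hw0 (hcn n)
  have hint' : ∀ n : ℕ, IntegrableOn (fun r : ℝ => (r : ℂ) ^ (w - 1) *
        exp (-((Real.pi * ((n : ℝ) + 1) ^ 2 : ℝ) * c * r)) * m r) (Ioi 0) := fun n =>
    (hint n).mul_bdd (c := C) (hm.aestronglyMeasurable measurableSet_Ioi)
      ((ae_restrict_mem measurableSet_Ioi).mono fun r hr => hC r hr)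
  have hsum : Summable fun n : ℕ => ∫ r in Ioi (0 : ℝ), ‖(r : ℂ) ^ (w - 1) *
        exp (-((Real.pi * ((n : ℝ) + 1) ^ 2 : ℝ) * c * r)) * m r‖ := by
    have hs : Summable (fun n : ℕ => ((n : ℝ) + 1) ^ (-(2 * w.re))) := by
      have := (summable_nat_add_iff 1).2
        (Real.summable_nat_rpow.2 (show -(2 * w.re) < -1 by linarith))
      simpa using this
    refine Summable.of_nonneg_of_le (fun n => integral_nonneg fun r => norm_nonneg _)
      (fun n => ?_) (hs.mul_left (C * ((Real.pi * c.re) ^ (-w.re) * Real.Gamma w.re)))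
    have hb : ∫ r in Ioi (0 : ℝ), ‖(r : ℂ) ^ (w - 1) *
        exp (-((Real.pi * ((n : ℝ) + 1) ^ 2 : ℝ) * c * r)) * m r‖ ≤
        ∫ r in Ioi (0 : ℝ), C * (r ^ (w.re - 1) *
          Real.exp (-(Real.pi * ((n : ℝ) + 1) ^ 2 * c.re * r))) := by
      have heq : ∀ r : ℝ, 0 < r → ‖(r : ℂ) ^ (w - 1) *
          exp (-((Real.pi * ((n : ℝ) + 1) ^ 2 : ℝ) * c * r))‖ = r ^ (w.re - 1) *
          Real.exp (-(Real.pi * ((n : ℝ) + 1) ^ 2 * c.re * r)) := fun r hr => by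
        rw [norm_cpow_mul_exp_neg_mul _ _ hr, hre]
      refine setIntegral_mono_on (hint' n).norm (Integrable.const_mul ?_ _) measurableSet_Ioi ?_
      · exact IntegrableOn.congr_fun (hint n).norm (fun r hr => heq r hr) measurableSet_Ioi
      · intro r hr
        rw [norm_mul, heq r hr, mul_comm C]
        have hr' : 0 < r := hr
        exact mul_le_mul_of_nonneg_left (hC r hr) (by positivity)
    refine hb.trans (le_of_eq ?_)
    rw [integral_const_mul, Real.integral_rpow_mul_exp_neg_mul_Ioi hw0 (by positivity),
      one_div, Real.inv_rpow (by positivity), ← Real.rpow_neg (by positivity),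
      show Real.pi * ((n : ℝ) + 1) ^ 2 * c.re = Real.pi * c.re * ((n : ℝ) + 1) ^ (2 : ℝ) by
        rw [Real.rpow_two]; ring,
      Real.mul_rpow (by positivity) (by positivity), ← Real.rpow_mul (by positivity),
      show (2 : ℝ) * -w.re = -(2 * w.re) by ring]
    ring
  have := hasSum_integral_of_summable_integral_norm hint' hsum
  suffices hm : mellin (fun r : ℝ => halfTheta (c * r) * m r) w = _ by
    rw [hm]; exact this
  refine setIntegral_congr_fun measurableSet_Ioi fun r hr => ?_
  have hr' : 0 < r := hr
  have h := hasSum_halfTheta (z := c * r) (by simpa using mul_pos hc hr')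
  simp only [smul_eq_mul]
  rw [← mul_assoc, ← h.tsum_eq, ← tsum_mul_left, ← tsum_mul_right]
  refine tsum_congr fun n => ?_
  push_cast
  congr 4
  ring

/-! ### The incomplete gamma series as Mellin transforms. -/

/-- The Stieltjes representation at `π (n+1)² c`, with the reflection formula for `1/(Γ(w) Γ(1-w))`.
At a pole of `Γ(1-w)` both sides are `0`, by the default values of `Gamma` and of division. -/
theorem expQTerm_one_sub {c y w : ℂ} (hc : 0 < c.re) (hy : y ∈ slitPlane) (hw : 0 < w.re) (n : ℕ) :
    expQTerm (1 - w) (log c + log y) (n + 1) = sin (Real.pi * w) / Real.pi * (y ^ (1 - w) *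
      ∫ r in Ioi (0 : ℝ), (r : ℂ) ^ (w - 1) *
        exp (-((Real.pi * ((n : ℝ) + 1) ^ 2 : ℝ) * c * r)) * (y + r)⁻¹) := by
  have hc0 : c ≠ 0 := by rintro rfl; simp at hc
  have hN : 0 < Real.pi * ((n : ℝ) + 1) ^ 2 := by positivity
  have hcn : 0 < ((Real.pi * ((n : ℝ) + 1) ^ 2 : ℝ) * c).re := by
    rw [re_ofReal_mul]; positivity
  have hsin : sin (Real.pi * w) / Real.pi = (Gamma w * Gamma (1 - w))⁻¹ := by
    rw [Gamma_mul_Gamma_one_sub, inv_div]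
  rw [hsin, ← upperIncompleteGamma_mul_exp_mul_Gamma hw hcn hy, expQTerm,
    normalizedIncompleteGamma, log_ofReal_mul hN hc0, exp_add, exp_log hc0,
    exp_log (slitPlane_ne_zero hy)]
  have hG := Gamma_ne_zero_of_re_pos hw
  have e1 : log c + log y + (Real.log (Real.pi * ((n + 1 : ℕ) : ℝ) ^ 2) : ℝ) =
      (Real.log (Real.pi * ((n : ℝ) + 1) ^ 2) : ℝ) + log c + log y := by
    push_cast; ring
  have e2 : (Real.pi : ℂ) * (c * y) * ((n + 1 : ℕ) : ℂ) ^ 2 =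
      (Real.pi * ((n : ℝ) + 1) ^ 2 : ℝ) * c * y := by
    push_cast; ring
  rw [e1, e2, mul_inv, div_eq_mul_inv]
  field_simp

theorem hasSum_expQTerm {c y w : ℂ} (hc : 0 < c.re) (hy : y ∈ slitPlane) (hw : 1 / 2 < w.re) :
    HasSum (fun n : ℕ => expQTerm (1 - w) (log c + log y) (n + 1))
      (sin (Real.pi * w) / Real.pi *
        (y ^ (1 - w) * mellin (fun r : ℝ => halfTheta (c * r) * (y + r)⁻¹) w)) := by
  obtain ⟨C, -, hC⟩ := exists_norm_inv_add_le_const hy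
  simp_rw [expQTerm_one_sub hc hy (show 0 < w.re by linarith)]
  exact ((hasSum_integral_exp_mul hc hw ((continuousOn_inv_add hy).mono Ioi_subset_Ici_self)
    fun r hr => hC r hr.le).mul_left _).mul_left _

/-! ### The zeta function and theta inversion. -/

/-- Riemann's integral for zeta, taken along the ray through `c`. -/
theorem cpow_mul_mellin_halfTheta {c s : ℂ} (hc : 0 < c.re) (hs : 1 < s.re) :
    c ^ (s / 2) * mellin (fun r : ℝ => halfTheta (c * r)) (s / 2) =
      (Real.pi : ℂ) ^ (-s / 2) * Gamma (s / 2) * riemannZeta s := by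
  have hc0 : c ≠ 0 := by rintro rfl; simp at hc
  have hw : 1 / 2 < (s / 2).re := by
    have : (s / 2).re = s.re / 2 := by simp
    linarith
  have h := (hasSum_integral_exp_mul hc hw (m := fun _ => 1) (C := 1) continuousOn_const
    (by simp)).tsum_eq
  simp only [mul_one] at h
  rw [← h, zeta_eq_tsum_one_div_nat_add_one_cpow hs, ← tsum_mul_left, ← tsum_mul_left]
  refine tsum_congr fun n => ?_
  have hN : 0 < Real.pi * ((n : ℝ) + 1) ^ 2 := by positivity
  have hn : (0 : ℝ) < (n : ℝ) + 1 := by positivity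
  have hcn : 0 < ((Real.pi * ((n : ℝ) + 1) ^ 2 : ℝ) * c).re := by
    rw [re_ofReal_mul]; positivity
  have hcn0 : ((Real.pi * ((n : ℝ) + 1) ^ 2 : ℝ) : ℂ) * c ≠ 0 :=
    mul_ne_zero (ofReal_ne_zero.2 hN.ne') hc0
  rw [integral_cpow_mul_exp_neg_mul_Ioi_of_re_pos (by linarith) hcn, one_div, ← cpow_neg,
    cpow_def_of_ne_zero hcn0, log_ofReal_mul hN hc0, cpow_def_of_ne_zero hc0,
    cpow_def_of_ne_zero (ofReal_ne_zero.2 Real.pi_ne_zero),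
    cpow_def_of_ne_zero (by exact_mod_cast hn.ne'), Real.log_mul Real.pi_ne_zero (by positivity),
    Real.log_pow, ← ofReal_natCast, ← ofReal_one, ← ofReal_add, ← ofReal_log Real.pi_pos.le,
    ← ofReal_log hn.le, ← mul_assoc, ← exp_add, mul_right_comm _ (Gamma _), ← exp_add]
  congr 2
  push_cast
  ring

/-- After `r → 1/r` the modular relation and `y/(y+r) = 1 - r/(y+r)` make this an identity between
integrands. The bounds on `Re s` are those that make all four integrals on the right converge
separately. -/
theorem mellin_halfTheta_inv_mul_inv_add {c y s : ℂ} (hc : 0 < c.re) (hy : y ∈ slitPlane)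
    (hs₁ : 1 < s.re) (hs₂ : s.re < 2) :
    c ^ ((s - 1) / 2) * mellin (fun r : ℝ => halfTheta (c⁻¹ * r) * (y⁻¹ + r)⁻¹) ((3 - s) / 2) =
      c ^ (s / 2) * mellin (fun r : ℝ => halfTheta (c * r)) (s / 2) -
      c ^ (s / 2) * mellin (fun r : ℝ => halfTheta (c * r) * (y + r)⁻¹) (s / 2 + 1) +
      c ^ (s / 2) / 2 * (y * mellin (fun r : ℝ => (y + r)⁻¹) (s / 2)) -
      c ^ ((s - 1) / 2) / 2 * (y * mellin (fun r : ℝ => (y + r)⁻¹) ((s - 1) / 2)) := by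
  have hc0 : c ≠ 0 := by rintro rfl; simp at hc
  have hy0 := slitPlane_ne_zero hy
  have r1 : (s / 2).re = s.re / 2 := by simp
  have r2 : ((s - 1) / 2).re = (s.re - 1) / 2 := by simp
  have r3 : (s / 2 + 1).re = s.re / 2 + 1 := by simp
  have i1 : MellinConvergent (fun r : ℝ => halfTheta (c * r)) (s / 2) :=
    mellinConvergent_halfTheta_mul hc (by rw [r1]; linarith)
  have i2 : MellinConvergent (fun r : ℝ => halfTheta (c * r) * (y + r)⁻¹) (s / 2 + 1) :=
    (mellin_halfTheta_mul_inv_add hc hy (by rw [r3]; linarith)).1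
  have i3 : MellinConvergent (fun r : ℝ => (y + r)⁻¹) (s / 2) :=
    mellinConvergent_inv_add hy (by rw [r1]; linarith) (by rw [r1]; linarith)
  have i4 : MellinConvergent (fun r : ℝ => (y + r)⁻¹) ((s - 1) / 2) :=
    mellinConvergent_inv_add hy (by rw [r2]; linarith) (by rw [r2]; linarith)
  have hinv := mellin_comp_inv (fun r : ℝ => halfTheta (c⁻¹ * r) * (y⁻¹ + r)⁻¹) ((s - 3) / 2)
  rw [show -((s - 3) / 2) = (3 - s) / 2 by ring] at hinv
  rw [← hinv]
  simp only [mellin, MellinConvergent, IntegrableOn] at i1 i2 i3 i4 ⊢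
  simp only [← mul_assoc, ← integral_const_mul]
  replace i1 := i1.const_mul (c ^ (s / 2))
  replace i2 := i2.const_mul (c ^ (s / 2))
  replace i3 := i3.const_mul (c ^ (s / 2) / 2 * y)
  replace i4 := i4.const_mul (c ^ ((s - 1) / 2) / 2 * y)
  have i12 := i1.sub i2
  rw [Pi.sub_def] at i12
  have i123 := i12.add i3
  rw [Pi.add_def] at i123
  rw [← integral_sub i1 i2, ← integral_add i12 i3, ← integral_sub i123 i4]
  refine setIntegral_congr_fun measurableSet_Ioi fun r hr => ?_
  have hr' : 0 < r := hr
  have hr0 : (r : ℂ) ≠ 0 := ofReal_ne_zero.2 hr'.ne'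
  have hne := add_ofReal_ne_zero hy hr'.le
  have hne' : (r : ℂ) + y ≠ 0 := by rwa [add_comm]
  have hcr : 0 < (c * r).re := by simpa using mul_pos hc hr'
  have hth := halfTheta_inv hcr
  have hcrp : (c * r) ^ (1 / 2 : ℂ) = c ^ (1 / 2 : ℂ) * (r : ℂ) ^ (1 / 2 : ℂ) := by
    rw [cpow_def_of_ne_zero (mul_ne_zero hc0 hr0), mul_comm c, log_ofReal_mul hr' hc0,
      cpow_def_of_ne_zero hc0, cpow_def_of_ne_zero hr0, ← exp_add, ← ofReal_log hr'.le]
    congr 1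
    ring
  have k1 : c ^ (s / 2) = c ^ ((s - 1) / 2) * c ^ (1 / 2 : ℂ) := by
    rw [← cpow_add _ _ hc0]; congr 1; ring
  have k2 : (r : ℂ) ^ (s / 2 - 1) = (r : ℂ) ^ ((s - 3) / 2) * (r : ℂ) ^ (1 / 2 : ℂ) := by
    rw [← cpow_add _ _ hr0]; congr 1; ring
  have k3 : (r : ℂ) ^ (s / 2 + 1 - 1) =
      (r : ℂ) ^ ((s - 3) / 2) * (r : ℂ) ^ (1 / 2 : ℂ) * r := by
    rw [← cpow_add _ _ hr0]; nth_rw 3 [← cpow_one (r : ℂ)]; rw [← cpow_add _ _ hr0]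
    congr 1; ring
  have k4 : (r : ℂ) ^ ((s - 3) / 2 - 1) = (r : ℂ) ^ ((s - 3) / 2) * (r : ℂ)⁻¹ := by
    rw [← cpow_neg_one, ← cpow_add _ _ hr0]; rfl
  have k5 : (r : ℂ) ^ ((s - 1) / 2 - 1) = (r : ℂ) ^ ((s - 3) / 2) := by
    congr 1; ring
  have k6 : (y⁻¹ + (r : ℂ)⁻¹)⁻¹ = y * r * (y + r)⁻¹ := by
    field_simp
    ring
  have k7 : halfTheta (c⁻¹ * ((r⁻¹ : ℝ) : ℂ)) = halfTheta (c * r)⁻¹ := by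
    rw [mul_inv]; push_cast; rfl
  simp only [smul_eq_mul]
  rw [k7, hth, hcrp, k1, k2, k3, k4, k5]
  push_cast
  rw [k6]
  field_simp
  ring

/-! ### The identity for the completed zeta function and its continuation to the strip. -/

theorem sin_pi_mul_div_two_ne_zero {s : ℂ} (h₁ : -1 < s.re) (h₂ : s.re < 2) (h : s ≠ 0) :
    sin (Real.pi * s / 2) ≠ 0 := by
  intro h0
  obtain ⟨k, hk⟩ := sin_eq_zero_iff.1 h0
  have hs : s = ((2 * k : ℤ) : ℂ) := by
    have : (Real.pi : ℂ) ≠ 0 := ofReal_ne_zero.2 Real.pi_ne_zero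
    have h3 : (Real.pi : ℂ) * s = Real.pi * (2 * k) := by linear_combination 2 * hk
    push_cast
    exact mul_left_cancel₀ this h3
  rw [hs, intCast_re] at h₁ h₂
  have h3 : (-1 : ℤ) < 2 * k := by exact_mod_cast h₁
  have h4 : 2 * k < (2 : ℤ) := by exact_mod_cast h₂
  exact h (by rw [hs, show k = 0 by omega]; simp)

theorem cos_pi_mul_div_two_ne_zero {s : ℂ} (h₁ : -1 < s.re) (h₂ : s.re < 2) (h : s ≠ 1) :
    cos (Real.pi * s / 2) ≠ 0 := by
  intro h0
  obtain ⟨k, hk⟩ := cos_eq_zero_iff.1 h0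
  have hs : s = ((2 * k + 1 : ℤ) : ℂ) := by
    have : (Real.pi : ℂ) ≠ 0 := ofReal_ne_zero.2 Real.pi_ne_zero
    have h3 : (Real.pi : ℂ) * s = Real.pi * (2 * k + 1) := by linear_combination 2 * hk
    push_cast
    exact mul_left_cancel₀ this h3
  rw [hs, intCast_re] at h₁ h₂
  have h3 : (-1 : ℤ) < 2 * k + 1 := by exact_mod_cast h₁
  have h4 : 2 * k + 1 < (2 : ℤ) := by exact_mod_cast h₂
  exact h (by rw [hs, show k = 0 by omega]; simp)

theorem pi_cpow_mul_Gamma_mul_riemannZeta {s : ℂ} (h₁ : -1 < s.re) (h : s ≠ 0) :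
    (Real.pi : ℂ) ^ (-s / 2) * Gamma (s / 2) * riemannZeta s = completedRiemannZeta s := by
  have hG : Gammaℝ s ≠ 0 := by
    rw [Ne, Gammaℝ_eq_zero_iff]
    rintro ⟨n, hn⟩
    have hs : s = ((-(2 * n) : ℤ) : ℂ) := by rw [hn]; push_cast; ring
    rw [hs, intCast_re] at h₁
    have h3 : (-1 : ℤ) < -(2 * n) := by exact_mod_cast h₁
    exact h (by rw [hs, show n = 0 by omega]; simp)
  rw [← Gammaℝ_def, riemannZeta_def_of_ne_zero h, mul_div_cancel₀ _ hG]

theorem completedRiemannZeta_eq_of_one_lt_re {c y s : ℂ} (hc : 0 < c.re) (hy : y ∈ slitPlane)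
    (hs₁ : 1 < s.re) (hs₂ : s.re < 2) :
    completedRiemannZeta s =
      c ^ (s / 2) * mellin (fun r : ℝ => halfTheta (c * r) * (y + r)⁻¹) (s / 2 + 1) +
      c ^ ((s - 1) / 2) *
        mellin (fun r : ℝ => halfTheta (c⁻¹ * r) * (y⁻¹ + r)⁻¹) ((3 - s) / 2) -
      Real.pi * (c ^ (s / 2) * y ^ (s / 2)) / (2 * sin (Real.pi * s / 2)) -
      Real.pi * (c ^ ((s - 1) / 2) * y ^ ((s - 1) / 2)) / (2 * cos (Real.pi * s / 2)) := by
  have hy0 := slitPlane_ne_zero hy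
  have hs0 : s ≠ 0 := by rintro rfl; simp at hs₁; linarith
  have hs1 : s ≠ 1 := by rintro rfl; simp at hs₁
  have hsin := sin_pi_mul_div_two_ne_zero (by linarith) hs₂ hs0
  have hcos := cos_pi_mul_div_two_ne_zero (by linarith) hs₂ hs1
  have r1 : (s / 2).re = s.re / 2 := by simp
  have r2 : ((s - 1) / 2).re = (s.re - 1) / 2 := by simp
  have hy_mul : ∀ w : ℂ, y = y ^ w * y ^ (1 - w) := fun w => by
    rw [← cpow_add _ _ hy0]; simp
  have hG : ∀ w : ℂ, 0 < w.re → w.re < 1 →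
      y * mellin (fun r : ℝ => (y + r)⁻¹) w = y ^ w * (Real.pi / sin (Real.pi * w)) := by
    intro w h0 h1
    nth_rw 1 [hy_mul w]
    rw [mul_assoc, cpow_mul_mellin_inv_add hy h0 h1, mul_comm (Gamma _),
      Gamma_mul_Gamma_one_sub]
  have e3 := hG (s / 2) (by rw [r1]; linarith) (by rw [r1]; linarith)
  have e4 := hG ((s - 1) / 2) (by rw [r2]; linarith) (by rw [r2]; linarith)
  have hs3 : sin (Real.pi * ((s - 1) / 2)) = -cos (Real.pi * s / 2) := by
    rw [show (Real.pi : ℂ) * ((s - 1) / 2) = Real.pi * s / 2 - Real.pi / 2 by ring,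
      sin_sub_pi_div_two]
  rw [hs3] at e4
  rw [← mul_div_assoc (Real.pi : ℂ) s 2] at e3
  rw [mellin_halfTheta_inv_mul_inv_add hc hy hs₁ hs₂, cpow_mul_mellin_halfTheta hc hs₁,
    pi_cpow_mul_Gamma_mul_riemannZeta (by linarith) hs0, e3, e4]
  field_simp
  ring

/-- Multiplication by `2 z (z-1) sin (πz/2) cos (πz/2)` clears all poles, and `z (z-1)` times the
completed zeta function extends to the entire function `z (z-1) Λ₀(z) + 1`. The identity theorem
then applies on the connected strip. -/
theorem completedRiemannZeta_eq_of_differentiableAt {A P Q : ℂ → ℂ}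
    (hA : ∀ z : ℂ, -1 < z.re → z.re < 2 → DifferentiableAt ℂ A z)
    (hP : Differentiable ℂ P) (hQ : Differentiable ℂ Q)
    (h : ∀ z : ℂ, 1 < z.re → z.re < 2 → completedRiemannZeta z =
      A z - P z / (2 * sin (Real.pi * z / 2)) - Q z / (2 * cos (Real.pi * z / 2)))
    {s : ℂ} (hs₁ : -1 < s.re) (hs₂ : s.re < 2) (hs_ne_zero : s ≠ 0) (hs_ne_one : s ≠ 1) :
    completedRiemannZeta s =
      A s - P s / (2 * sin (Real.pi * s / 2)) - Q s / (2 * cos (Real.pi * s / 2)) := by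
  set U : Set ℂ := {z : ℂ | -1 < z.re} ∩ {z : ℂ | z.re < 2} with hU
  have hUo : IsOpen U :=
    (isOpen_lt continuous_const continuous_re).inter (isOpen_lt continuous_re continuous_const)
  have hUc : IsPreconnected U :=
    ((convex_halfSpace_re_gt (-1)).inter (convex_halfSpace_re_lt 2)).isPreconnected
  set F : ℂ → ℂ := fun z => 2 * sin (Real.pi * z / 2) * cos (Real.pi * z / 2) *
    (z * (z - 1) * completedRiemannZeta₀ z + 1) with hF
  set G : ℂ → ℂ := fun z => z * (z - 1) * (2 * sin (Real.pi * z / 2) * cos (Real.pi * z / 2) *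
    A z - P z * cos (Real.pi * z / 2) - Q z * sin (Real.pi * z / 2)) with hG
  have hFd : DifferentiableOn ℂ F U := by
    have := differentiable_completedZeta₀
    exact Differentiable.differentiableOn (by fun_prop)
  have hGd : DifferentiableOn ℂ G U := by
    intro z hz
    have := hA z hz.1 hz.2
    exact DifferentiableAt.differentiableWithinAt (by fun_prop)
  have hsplit : ∀ z : ℂ, z ≠ 0 → z ≠ 1 →
      z * (z - 1) * completedRiemannZeta₀ z + 1 = z * (z - 1) * completedRiemannZeta z := by
    intro z h0 h1
    have h1' : 1 - z ≠ 0 := sub_ne_zero.2 h1.symm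
    rw [completedRiemannZeta_eq]
    field_simp
    ring
  have hloc : F =ᶠ[𝓝 (3 / 2 : ℂ)] G := by
    have hV : {z : ℂ | 1 < z.re} ∩ {z : ℂ | z.re < 2} ∈ 𝓝 (3 / 2 : ℂ) :=
      ((isOpen_lt continuous_const continuous_re).inter
        (isOpen_lt continuous_re continuous_const)).mem_nhds (by constructor <;> norm_num)
    filter_upwards [hV] with z hz
    have hz1 : 1 < z.re := hz.1
    have hz2 : z.re < 2 := hz.2
    have h0 : z ≠ 0 := by rintro rfl; simp at hz1; linarith
    have h1 : z ≠ 1 := by rintro rfl; simp at hz1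
    have hsin := sin_pi_mul_div_two_ne_zero (by linarith) hz2 h0
    have hcos := cos_pi_mul_div_two_ne_zero (by linarith) hz2 h1
    simp only [hF, hG]
    rw [hsplit z h0 h1, h z hz1 hz2]
    field_simp
  have hEq := (hFd.analyticOnNhd hUo).eqOn_of_preconnected_of_eventuallyEq
    (hGd.analyticOnNhd hUo) hUc (show (3 / 2 : ℂ) ∈ U by constructor <;> norm_num) hloc
  have hs := hEq (show s ∈ U from ⟨hs₁, hs₂⟩)
  have hsin := sin_pi_mul_div_two_ne_zero hs₁ hs₂ hs_ne_zero
  have hcos := cos_pi_mul_div_two_ne_zero hs₁ hs₂ hs_ne_one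
  simp only [hF, hG] at hs
  rw [hsplit s hs_ne_zero hs_ne_one, mul_left_comm] at hs
  have hs' := mul_left_cancel₀ (mul_ne_zero hs_ne_zero (sub_ne_zero.2 hs_ne_one)) hs
  have h2 : 2 * sin (Real.pi * s / 2) * cos (Real.pi * s / 2) ≠ 0 :=
    mul_ne_zero (mul_ne_zero two_ne_zero hsin) hcos
  refine mul_left_cancel₀ h2 (hs'.trans ?_)
  field_simp

theorem inv_mem_slitPlane_of_mem {y : ℂ} (hy : y ∈ slitPlane) : y⁻¹ ∈ slitPlane := by
  rw [mem_slitPlane_iff_arg] at hy ⊢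
  refine ⟨?_, inv_ne_zero hy.2⟩
  rw [arg_inv, if_neg hy.1]
  exact fun h => (neg_pi_lt_arg y).ne' (by rw [← h, neg_neg])

theorem inv_re_pos {c : ℂ} (hc : 0 < c.re) : 0 < (c⁻¹).re := by
  have hc0 : c ≠ 0 := by rintro rfl; simp at hc
  rw [inv_re]
  exact div_pos hc (normSq_pos.2 hc0)

theorem completedRiemannZeta_eq_of_neg_one_lt_re {c y s : ℂ} (hc : 0 < c.re) (hy : y ∈ slitPlane)
    (hs₁ : -1 < s.re) (hs₂ : s.re < 2) (hs_ne_zero : s ≠ 0) (hs_ne_one : s ≠ 1) :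
    completedRiemannZeta s =
      c ^ (s / 2) * mellin (fun r : ℝ => halfTheta (c * r) * (y + r)⁻¹) (s / 2 + 1) +
      c ^ ((s - 1) / 2) *
        mellin (fun r : ℝ => halfTheta (c⁻¹ * r) * (y⁻¹ + r)⁻¹) ((3 - s) / 2) -
      Real.pi * (c ^ (s / 2) * y ^ (s / 2)) / (2 * sin (Real.pi * s / 2)) -
      Real.pi * (c ^ ((s - 1) / 2) * y ^ ((s - 1) / 2)) / (2 * cos (Real.pi * s / 2)) := by
  have hc0 : c ≠ 0 := by rintro rfl; simp at hc
  have hy0 := slitPlane_ne_zero hy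
  have hp1 : ∀ b : ℂ, b ≠ 0 → Differentiable ℂ (fun z : ℂ => b ^ (z / 2)) := fun b hb =>
    (differentiable_id.div_const 2).const_cpow (Or.inl hb)
  have hp2 : ∀ b : ℂ, b ≠ 0 → Differentiable ℂ (fun z : ℂ => b ^ ((z - 1) / 2)) := fun b hb =>
    ((differentiable_id.sub_const 1).div_const 2).const_cpow (Or.inl hb)
  refine completedRiemannZeta_eq_of_differentiableAt
    (A := fun s => c ^ (s / 2) *
      mellin (fun r : ℝ => halfTheta (c * r) * (y + r)⁻¹) (s / 2 + 1) + c ^ ((s - 1) / 2) *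
        mellin (fun r : ℝ => halfTheta (c⁻¹ * r) * (y⁻¹ + r)⁻¹) ((3 - s) / 2))
    (P := fun s => Real.pi * (c ^ (s / 2) * y ^ (s / 2)))
    (Q := fun s => Real.pi * (c ^ ((s - 1) / 2) * y ^ ((s - 1) / 2)))
    (fun z hz₁ hz₂ => ?_) (((hp1 c hc0).mul (hp1 y hy0)).const_mul _)
    (((hp2 c hc0).mul (hp2 y hy0)).const_mul _)
    (fun z => completedRiemannZeta_eq_of_one_lt_re hc hy) hs₁ hs₂ hs_ne_zero hs_ne_one
  have hre₁ : 1 / 2 < (z / 2 + 1).re := by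
    have : (z / 2 + 1).re = z.re / 2 + 1 := by simp
    linarith
  have hre₂ : 1 / 2 < ((3 - z) / 2).re := by
    have : ((3 - z) / 2).re = (3 - z.re) / 2 := by simp
    linarith
  have d₁ := (mellin_halfTheta_mul_inv_add hc hy hre₁).2.comp z
    (f := fun z : ℂ => z / 2 + 1) (by fun_prop)
  have d₂ := (mellin_halfTheta_mul_inv_add (inv_re_pos hc) (inv_mem_slitPlane_of_mem hy)
    hre₂).2.comp z (f := fun z : ℂ => (3 - z) / 2) (by fun_prop)
  exact ((hp1 c hc0 z).mul d₁).add ((hp2 c hc0 z).mul d₂)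

/-! ### Splitting `τ` and assembling the formula. -/

theorem exists_log_add_log_eq {ℓ : ℂ} (hℓ : |ℓ.im| < 3 * Real.pi / 2) :
    ∃ c y : ℂ, 0 < c.re ∧ y ∈ slitPlane ∧ log c + log y = ℓ := by
  obtain ⟨h1, h2⟩ := abs_lt.1 hℓ
  have hpi := Real.pi_pos
  -- One third of the argument goes to `c`, below `π/2` in absolute value, and two thirds to `y`,
  -- below `π`.
  refine ⟨exp ((ℓ.im / 3 : ℝ) * I), exp (ℓ - (ℓ.im / 3 : ℝ) * I), ?_, ?_, ?_⟩
  · rw [exp_ofReal_mul_I_re]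
    exact Real.cos_pos_of_mem_Ioo ⟨by linarith, by linarith⟩
  · rw [mem_slitPlane_iff_arg]
    refine ⟨fun h => ?_, exp_ne_zero _⟩
    have hlog := congrArg im (log_exp (x := ℓ - (ℓ.im / 3 : ℝ) * I)
      (by simp; linarith) (by simp; linarith))
    rw [log_im, h] at hlog
    simp at hlog
    linarith
  · rw [log_exp (by simp; linarith) (by simp; linarith),
      log_exp (by simp; linarith) (by simp; linarith)]
    ring

end

theorem mainTheorem3 (s ℓ : ℂ) (hs₁ : -1 < s.re) (hs₂ : s.re < 2) (hs_ne_zero : s ≠ 0)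
    (hs_ne_one : s ≠ 1) (hℓ : |ℓ.im| < 3 * Real.pi / 2) :
    Summable (fun n : ℕ => expQTerm (-s / 2) ℓ (n + 1)) ∧
    Summable (fun n : ℕ => expQTerm ((s - 1) / 2) (-ℓ) (n + 1)) ∧
    (Real.pi : ℂ) ^ (-s / 2) * Complex.Gamma (s / 2) * riemannZeta s =
      -(Real.pi * Complex.exp (s / 2 * ℓ) / Complex.sin (Real.pi * s / 2)) *
          (1 / 2 + ∑' n : ℕ, expQTerm (-s / 2) ℓ (n + 1))
      - Real.pi * Complex.exp ((s - 1) / 2 * ℓ) / Complex.cos (Real.pi * s / 2) *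
          (1 / 2 + ∑' n : ℕ, expQTerm ((s - 1) / 2) (-ℓ) (n + 1)) := by
  obtain ⟨c, y, hc, hy, rfl⟩ := exists_log_add_log_eq hℓ
  have hc0 : c ≠ 0 := by rintro rfl; simp at hc
  have hy0 := Complex.slitPlane_ne_zero hy
  have hcs : c ∈ Complex.slitPlane := Or.inl hc
  have hneg : -(Complex.log c + Complex.log y) = Complex.log c⁻¹ + Complex.log y⁻¹ := by
    rw [Complex.log_inv _ (Complex.slitPlane_arg_ne_pi hcs),
      Complex.log_inv _ (Complex.slitPlane_arg_ne_pi hy)]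
    ring
  have S₁ := hasSum_expQTerm hc hy (w := s / 2 + 1) (by
    have : (s / 2 + 1).re = s.re / 2 + 1 := by simp
    linarith)
  have S₂ := hasSum_expQTerm (inv_re_pos hc) (inv_mem_slitPlane_of_mem hy) (w := (3 - s) / 2) (by
    have : ((3 - s) / 2).re = (3 - s.re) / 2 := by simp
    linarith)
  -- The shift by `π` gives `-sin (πs/2)` here and `-cos (πs/2)` in the second series; these signs
  -- cancel the minus signs of the two prefactors.
  rw [show 1 - (s / 2 + 1) = -s / 2 by ring,
    show (Real.pi : ℂ) * (s / 2 + 1) = Real.pi * s / 2 + Real.pi by ring,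
    Complex.sin_add_pi] at S₁
  rw [← hneg, show 1 - (3 - s) / 2 = (s - 1) / 2 by ring,
    show (Real.pi : ℂ) * ((3 - s) / 2) = Real.pi / 2 - Real.pi * s / 2 + Real.pi by ring,
    Complex.sin_add_pi, Complex.sin_pi_div_two_sub,
    Complex.inv_cpow _ _ (Complex.slitPlane_arg_ne_pi hy)] at S₂
  refine ⟨S₁.summable, S₂.summable, ?_⟩
  -- The powers of `τ` split, and their `y`-parts cancel the factors `y^(-s/2)` and
  -- `(1/y)^((s-1)/2)` of the two sums.
  have hexp : ∀ w : ℂ, Complex.exp (w * (Complex.log c + Complex.log y)) = c ^ w * y ^ w := by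
    intro w
    rw [Complex.cpow_def_of_ne_zero hc0, Complex.cpow_def_of_ne_zero hy0, ← Complex.exp_add]
    congr 1
    ring
  have hsin := sin_pi_mul_div_two_ne_zero hs₁ hs₂ hs_ne_zero
  have hcos := cos_pi_mul_div_two_ne_zero hs₁ hs₂ hs_ne_one
  have hpi : (Real.pi : ℂ) ≠ 0 := Complex.ofReal_ne_zero.2 Real.pi_ne_zero
  have hy1 : y ^ (s / 2) ≠ 0 := by simp [Complex.cpow_eq_zero_iff, hy0]
  have hy2 : y ^ ((s - 1) / 2) ≠ 0 := by simp [Complex.cpow_eq_zero_iff, hy0]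
  rw [pi_cpow_mul_Gamma_mul_riemannZeta hs₁ hs_ne_zero, S₁.tsum_eq, S₂.tsum_eq, hexp, hexp,
    completedRiemannZeta_eq_of_neg_one_lt_re hc hy hs₁ hs₂ hs_ne_zero hs_ne_one,
    show -s / 2 = -(s / 2) by ring, Complex.cpow_neg y (s / 2)]
  generalize mellin (fun r : ℝ => halfTheta (c * r) * (y + r)⁻¹) (s / 2 + 1) = M₁
  generalize mellin (fun r : ℝ => halfTheta (c⁻¹ * r) * (y⁻¹ + r)⁻¹) ((3 - s) / 2) = M₂
  generalize Complex.sin (Real.pi * s / 2) = S at *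
  generalize Complex.cos (Real.pi * s / 2) = C at *
  field_simp
  ring
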